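/- Let $\mathbb{D}$ be the open unit disc of $\mathbb{C}$, let $A$ be analytic in $\mathbb{D}$, and let $f_1,f_2$ be linearly independent (analytic) solutions of $f''+Af=0$ in $\mathbb{D}$. For a meromorphic function $w$ in $\mathbb{D}$ let $w^\#=|w'|/(1+|w|^2)$ be its spherical derivative (extended continuously to the poles of $w$), and put $u=-\log\,(f_1/f_2)^\#$. Then $(f_1/f_2)^\#$ is strictly positive and $u$ is real differentiable in $\mathbb{D}$, so that $\nabla u$ is defined everywhere in $\mathbb{D}$, and the following hold. For a function $\omega:\mathbb{D}\to(0,\infty)$ let $L^\infty_\omega$ be the set of functions $f$ on $\mathbb{D}$ with $\sup_{z\in\mathbb{D}}|f(z)|\,\omega(z)<\infty$, and let $H^\infty_\omega$ be the set of analytic functions in $L^\infty_\omega$. For $0\le\alpha<\infty$ write $L^\infty_\alpha$ and $H^\infty_\alpha$ for these spaces with $\omega(z)=(1-|z|^2)^\alpha$. A bounded continuous function $\omega:\mathbb{D}\to(0,\infty)$ is called a regular weight if $\omega(z)=\omega(|z|)$ for all $z\in\mathbb{D}$ and for each $0\le s<1$ there exists a constant $1\le C<\infty$, depending only on $s$ and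 $\omega$, such that $C^{-1}\omega(t)\le\omega(r)\le C\,\omega(t)$ whenever $0\le r\le t\le r+s(1-r)<1$. (a) If $\omega$ is a regular weight with $\sup_{z\in\mathbb{D}}\omega(z)/(1-|z|)<\infty$, then $|\nabla u|\in L^\infty_\omega$ if and only if $A\in H^\infty_{\omega^2}$ and $(f_1/f_2)^\#\in L^\infty_\omega$. (b) $|\nabla u|\in L^\infty_1$ if and only if $A\in H^\infty_2$ and $f_1/f_2$ is normal, where a meromorphic function $w$ in $\mathbb{D}$ is called normal if $\sup_{z\in\mathbb{D}} w^\#(z)(1-|z|^2)<\infty$. -/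

import Mathlib

open Filter Topology

/-- The open unit disc of the complex plane. -/
abbrev disc : Set ℂ := Metric.ball (0 : ℂ) 1

/-- The spherical derivative `|w'| / (1 + |w|²)` of a meromorphic function `w`. It is taken as a
limit over the punctured neighbourhood, so that the formula is extended continuously to the poles
of `w` and the values which the total function `w` has there play no role. -/
noncomputable def sphericalDeriv (w : ℂ → ℂ) (z : ℂ) : ℝ :=
  limUnder (𝓝[≠] z) (fun ζ => ‖deriv w ζ‖ / (1 + ‖w ζ‖ ^ 2))

/-- `f` is an analytic solution of `f'' + A f = 0` in the unit disc. -/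
structure IsSolution (A f : ℂ → ℂ) : Prop where
  analytic : AnalyticOnNhd ℂ f disc
  ode : ∀ z ∈ disc, deriv (deriv f) z + A z * f z = 0

/-- A weight on the unit disc: a bounded, continuous, strictly positive function. -/
structure IsWeight (ω : ℂ → ℝ) : Prop where
  pos : ∀ z ∈ disc, 0 < ω z
  bounded : ∃ C : ℝ, ∀ z ∈ disc, ω z ≤ C
  continuousOn : ContinuousOn ω disc

/-- A regular weight: a radial weight with `ω(r) ≍ ω(t)` for `r ≤ t ≤ r + s (1 - r)`, where the
comparison constant depends on `ω` and `s` only. -/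
structure IsRegularWeight (ω : ℂ → ℝ) : Prop extends IsWeight ω where
  radial : ∀ z ∈ disc, ω z = ω ((‖z‖ : ℝ) : ℂ)
  regular : ∀ s : ℝ, 0 ≤ s → s < 1 → ∃ C : ℝ, 1 ≤ C ∧
    ∀ r t : ℝ, 0 ≤ r → r ≤ t → t ≤ r + s * (1 - r) → r + s * (1 - r) < 1 →
      C⁻¹ * ω (t : ℂ) ≤ ω (r : ℂ) ∧ ω (r : ℂ) ≤ C * ω (t : ℂ)

/-- `f ∈ L^∞_ω`: the supremum of `|f| ω` over the unit disc is finite. -/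
def MemLinfty {E : Type*} [Norm E] (ω : ℂ → ℝ) (f : ℂ → E) : Prop :=
  BddAbove ((fun z => ‖f z‖ * ω z) '' disc)

/-- `f ∈ H^∞_ω`: `f` is analytic in the unit disc and belongs to `L^∞_ω`. -/
def MemHinfty (ω : ℂ → ℝ) (f : ℂ → ℂ) : Prop :=
  AnalyticOnNhd ℂ f disc ∧ MemLinfty ω f

/-- The standard weight `(1 - |z|²) ^ α`; it gives the spaces `L^∞_α` and `H^∞_α`. -/
noncomputable def stdWeight (α : ℝ) (z : ℂ) : ℝ := (1 - ‖z‖ ^ 2) ^ α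

/-- A normal function: `w` is meromorphic in the unit disc, and the supremum of
`w^# (z) (1 - |z|²)` over the unit disc is finite. -/
def IsNormalFunction (w : ℂ → ℂ) : Prop :=
  MeromorphicOn w disc ∧ BddAbove ((fun z => sphericalDeriv w z * (1 - ‖z‖ ^ 2)) '' disc)

/-- The function `u = - log (f₁ / f₂)^#`. -/
noncomputable def uFun (f₁ f₂ : ℂ → ℂ) (z : ℂ) : ℝ :=
  -Real.log (sphericalDeriv (fun ζ => f₁ ζ / f₂ ζ) z)

open ComplexConjugate

/-! Put `h = (f₁, f₂)`, so `h'' = -A h`, and let `c ≠ 0` be the constant Wronskian. Then `(f₁/f₂)^#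
= ‖c‖ / ‖h‖²`, so `u = log ‖h‖² - log ‖c‖`, and everything reduces to comparing `h`, `h'` and `h''`
on discs of radius `R` comparable to `ω z`. A bound on `R |∇u|` keeps `‖h‖` below a multiple of its
central value, so Cauchy's estimates control `h'` and `h''`, hence the spherical derivative and `A`
(`bounds_of_norm_gradient_le`). Conversely, `|∇u| ≤ 2 ‖h'‖ / ‖h‖`. If this quotient were large at
`z`, smallness of `R² A` would make `h` nearly affine, so `‖h‖` would attain its minimum inside the
disc. There `h ⟂ h'`, so `‖c‖ = ‖h‖ ‖h'‖`, and the bound on `(f₁/f₂)^#` controls `h'` there, hence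
at `z` (`norm_deriv_le_of_wronskian_le`). -/

/-! ### The vector solution and Lagrange's identity. -/

/-- The vector-valued function with components `f₁` and `f₂`. -/
noncomputable def solutionPair (f₁ f₂ : ℂ → ℂ) (z : ℂ) : EuclideanSpace ℂ (Fin 2) :=
  !₂[f₁ z, f₂ z]

lemma solutionPair_norm_sq (f₁ f₂ : ℂ → ℂ) (z : ℂ) :
    ‖solutionPair f₁ f₂ z‖ ^ 2 = ‖f₁ z‖ ^ 2 + ‖f₂ z‖ ^ 2 := by
  simp [solutionPair, EuclideanSpace.norm_sq_eq]

lemma HasDerivAt.solutionPair {f₁ f₂ g₁ g₂ : ℂ → ℂ} {z : ℂ} (h₁ : HasDerivAt f₁ (g₁ z) z)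
    (h₂ : HasDerivAt f₂ (g₂ z) z) :
    HasDerivAt (solutionPair f₁ f₂) (solutionPair g₁ g₂ z) z := by
  have h : HasDerivAt (fun ζ => ![f₁ ζ, f₂ ζ]) ![g₁ z, g₂ z] z := by
    rw [hasDerivAt_pi]
    intro i
    fin_cases i
    · simpa using h₁
    · simpa using h₂
  exact (PiLp.continuousLinearEquiv 2 ℂ (fun _ : Fin 2 => ℂ)).symm.hasFDerivAt.comp_hasDerivAt z h

lemma lagrange_identity (x₁ x₂ y₁ y₂ : ℂ) :
    ‖conj x₁ * y₁ + conj x₂ * y₂‖ ^ 2 + ‖y₁ * x₂ - x₁ * y₂‖ ^ 2 =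
      (‖x₁‖ ^ 2 + ‖x₂‖ ^ 2) * (‖y₁‖ ^ 2 + ‖y₂‖ ^ 2) := by
  simp only [← Complex.normSq_eq_norm_sq, Complex.normSq_apply, Complex.add_re, Complex.add_im,
    Complex.sub_re, Complex.sub_im, Complex.mul_re, Complex.mul_im, Complex.conj_re,
    Complex.conj_im]
  ring

lemma hasFDerivAt_norm_sq_add_norm_sq {f₁ f₂ : ℂ → ℂ} {y₁ y₂ z : ℂ} (h₁ : HasDerivAt f₁ y₁ z)
    (h₂ : HasDerivAt f₂ y₂ z) :
    HasFDerivAt (fun ζ => ‖f₁ ζ‖ ^ 2 + ‖f₂ ζ‖ ^ 2)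
      (Complex.reCLM.comp
        ((2 * (conj (f₁ z) * y₁ + conj (f₂ z) * y₂)) • (ContinuousLinearMap.id ℝ ℂ))) z := by
  have e₁ := (h₁.hasFDerivAt.restrictScalars ℝ).norm_sq
  have e₂ := (h₂.hasFDerivAt.restrictScalars ℝ).norm_sq
  refine (e₁.add e₂).congr_fderiv ?_
  ext <;>
    (simp [Complex.inner]; ring)

/-! ### Solutions on small discs: nearly affine behaviour and the minimum argument. -/

section Growth

variable {E : Type*} [NormedAddCommGroup E] [NormedSpace ℂ E]

/-- With `M` the maximum of `‖h‖`, the equation gives `‖h''‖ ≤ M / (4R²)`. Two uses of the mean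
value inequality show that `h` is affine up to `M / 4`, and evaluating at a maximum point absorbs
`M`. -/
lemma exists_bound_of_second_order_ode {h h' : ℂ → E} {a : ℂ → ℂ} {z : ℂ} {R : ℝ} (hR : 0 < R)
    (hd : ∀ ζ ∈ Metric.closedBall z R, HasDerivAt h (h' ζ) ζ)
    (hd' : ∀ ζ ∈ Metric.closedBall z R, HasDerivAt h' (-(a ζ • h ζ)) ζ)
    (ha : ∀ ζ ∈ Metric.closedBall z R, ‖a ζ‖ * R ^ 2 ≤ 1 / 4) :
    ∃ M : ℝ, (∀ ζ ∈ Metric.closedBall z R, ‖h ζ‖ ≤ M ∧ R * ‖h' ζ - h' z‖ ≤ M / 4 ∧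
      ‖h ζ - h z - (ζ - z) • h' z‖ ≤ M / 4) ∧ M ≤ 4 / 3 * (‖h z‖ + R * ‖h' z‖) := by
  have hz : z ∈ Metric.closedBall z R := Metric.mem_closedBall_self hR.le
  obtain ⟨ζm, hζm, hmax⟩ := (isCompact_closedBall z R).exists_isMaxOn ⟨z, hz⟩
    (f := fun ζ => ‖h ζ‖) (fun ζ hζ => (hd ζ hζ).continuousAt.norm.continuousWithinAt)
  have hM : ∀ ζ ∈ Metric.closedBall z R, ‖h ζ‖ ≤ ‖h ζm‖ := fun ζ hζ => hmax hζ
  set M := ‖h ζm‖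
  have hM0 : 0 ≤ M := norm_nonneg _
  have hder : ∀ ζ ∈ Metric.closedBall z R, R * ‖h' ζ - h' z‖ ≤ M / 4 := by
    intro ζ hζ
    have := (convex_closedBall z R).norm_image_sub_le_of_norm_hasDerivWithin_le (f := h')
      (C := 1 / (4 * R ^ 2) * M) (fun x hx => (hd' x hx).hasDerivWithinAt) (fun x hx => by
        rw [norm_neg, norm_smul]
        have : ‖a x‖ ≤ 1 / (4 * R ^ 2) := by
          rw [le_div_iff₀ (by positivity)]
          linarith [ha x hx]
        exact mul_le_mul this (hM x hx) (norm_nonneg _) (by positivity)) hz hζ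
    rw [mem_closedBall_iff_norm] at hζ
    calc R * ‖h' ζ - h' z‖ ≤ R * (1 / (4 * R ^ 2) * M * R) := by
          refine mul_le_mul_of_nonneg_left (this.trans ?_) hR.le
          exact mul_le_mul_of_nonneg_left hζ (by positivity)
      _ = M / 4 := by field_simp
  have hval : ∀ ζ ∈ Metric.closedBall z R, ‖h ζ - h z - (ζ - z) • h' z‖ ≤ M / 4 := by
    intro ζ hζ
    have := (convex_closedBall z R).norm_image_sub_le_of_norm_hasDerivWithin_le
      (f := fun x => h x - (x - z) • h' z) (f' := fun x => h' x - h' z)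
      (C := M / (4 * R)) (fun x hx => by
        have h2 : HasDerivAt (fun x => (x - z) • h' z) ((1 : ℂ) • h' z) x :=
          ((hasDerivAt_id x).sub_const z).smul_const (h' z)
        rw [one_smul] at h2
        exact ((hd x hx).sub h2).hasDerivWithinAt) (fun x hx => by
        rw [le_div_iff₀ (by positivity)]
        linarith [hder x hx]) hz hζ
    rw [mem_closedBall_iff_norm] at hζ
    have e : h ζ - (ζ - z) • h' z - (h z - (z - z) • h' z) = h ζ - h z - (ζ - z) • h' z := by
      simp only [sub_self, zero_smul]
      abel
    rw [e] at this
    calc _ ≤ M / (4 * R) * R := this.trans (mul_le_mul_of_nonneg_left hζ (by positivity))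
      _ = M / 4 := by field_simp
  refine ⟨M, fun ζ hζ => ⟨hM ζ hζ, hder ζ hζ, hval ζ hζ⟩, ?_⟩
  have h1 := hval ζm hζm
  have h2 : M ≤ ‖h ζm - h z - (ζm - z) • h' z‖ + ‖h z‖ + ‖(ζm - z) • h' z‖ := by
    calc M = ‖(h ζm - h z - (ζm - z) • h' z) + h z + (ζm - z) • h' z‖ := by
          refine congrArg norm ?_
          abel
      _ ≤ _ := norm_add₃_le
  rw [norm_smul] at h2
  have h3 : ‖ζm - z‖ * ‖h' z‖ ≤ R * ‖h' z‖ :=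
    mul_le_mul_of_nonneg_right (mem_closedBall_iff_norm.1 hζm) (norm_nonneg _)
  linarith

end Growth

lemma norm_deriv_le_of_wronskian_le {f₁ f₂ g₁ g₂ a : ℂ → ℂ} {c z : ℂ} {R C : ℝ} (hR : 0 < R)
    (h₁ : ∀ ζ ∈ Metric.closedBall z R, HasDerivAt f₁ (g₁ ζ) ζ)
    (h₂ : ∀ ζ ∈ Metric.closedBall z R, HasDerivAt f₂ (g₂ ζ) ζ)
    (h₁' : ∀ ζ ∈ Metric.closedBall z R, HasDerivAt g₁ (-(a ζ * f₁ ζ)) ζ)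
    (h₂' : ∀ ζ ∈ Metric.closedBall z R, HasDerivAt g₂ (-(a ζ * f₂ ζ)) ζ)
    (hc : c ≠ 0)
    (hW : ∀ ζ ∈ Metric.closedBall z R, g₁ ζ * f₂ ζ - f₁ ζ * g₂ ζ = c)
    (ha : ∀ ζ ∈ Metric.closedBall z R, ‖a ζ‖ * R ^ 2 ≤ 1 / 4)
    (hC : ∀ ζ ∈ Metric.closedBall z R, R * ‖c‖ ≤ C * (‖f₁ ζ‖ ^ 2 + ‖f₂ ζ‖ ^ 2)) :
    R * ‖solutionPair g₁ g₂ z‖ ≤ (4 + 2 * C) * ‖solutionPair f₁ f₂ z‖ := by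
  set h := solutionPair f₁ f₂ with hh
  set h' := solutionPair g₁ g₂ with hh'
  have hz : z ∈ Metric.closedBall z R := Metric.mem_closedBall_self hR.le
  have hd : ∀ ζ ∈ Metric.closedBall z R, HasDerivAt h (h' ζ) ζ :=
    fun ζ hζ => (h₁ ζ hζ).solutionPair (h₂ ζ hζ)
  have hd' : ∀ ζ ∈ Metric.closedBall z R, HasDerivAt h' (-(a ζ • h ζ)) ζ := by
    intro ζ hζ
    have := HasDerivAt.solutionPair (g₁ := fun ζ => -(a ζ * f₁ ζ)) (g₂ := fun ζ => -(a ζ * f₂ ζ))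
      (h₁' ζ hζ) (h₂' ζ hζ)
    convert this using 1
    ext i
    fin_cases i <;> simp [hh, solutionPair]
  obtain ⟨M, hM, hMle⟩ := exists_bound_of_second_order_ode hR hd hd' ha
  have hC0 : 0 < C := by
    have h1 := hC z hz
    have h2 : 0 < R * ‖c‖ := mul_pos hR (norm_pos_iff.2 hc)
    by_contra hneg
    nlinarith [sq_nonneg ‖f₁ z‖, sq_nonneg ‖f₂ z‖]
  by_contra hlt
  push Not at hlt
  have hp0 : 0 ≤ ‖h z‖ := norm_nonneg _
  have hq : 4 * ‖h z‖ ≤ R * ‖h' z‖ := by nlinarith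
  obtain ⟨ζ₀, hζ₀, hmin⟩ := (isCompact_closedBall z R).exists_isMinOn ⟨z, hz⟩
    (f := fun ζ => ‖h ζ‖) (fun ζ hζ => (hd ζ hζ).continuousAt.norm.continuousWithinAt)
  have hle : ∀ ζ ∈ Metric.closedBall z R, ‖h ζ₀‖ ≤ ‖h ζ‖ := fun ζ hζ => hmin hζ
  have hpos : ∀ ζ ∈ Metric.closedBall z R, 0 < ‖h ζ‖ := by
    intro ζ hζ
    have h2 : 0 < R * ‖c‖ := mul_pos hR (norm_pos_iff.2 hc)
    have h1 := hC ζ hζ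
    rw [← solutionPair_norm_sq] at h1
    refine norm_pos_iff.2 fun h0 => ?_
    rw [← hh, h0] at h1
    simp at h1
    linarith
  -- On the boundary circle the affine part has norm `R ‖h' z‖ ≥ 4 ‖h z‖`; a minimum there would
  -- force `R ‖h' z‖ ≤ 7/2 ‖h z‖`.
  have hball : ζ₀ ∈ Metric.ball z R := by
    rw [mem_ball_iff_norm]
    refine lt_of_le_of_ne (mem_closedBall_iff_norm.1 hζ₀) fun hbd => ?_
    have h1 := (hM ζ₀ hζ₀).2.2
    have h2 : ‖(ζ₀ - z) • h' z‖ ≤ ‖h ζ₀‖ + ‖h z‖ + ‖h ζ₀ - h z - (ζ₀ - z) • h' z‖ := by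
      calc _ = ‖h ζ₀ - h z - (h ζ₀ - h z - (ζ₀ - z) • h' z)‖ := by congr 1; abel
        _ ≤ _ := (norm_sub_le _ _).trans (add_le_add_left (norm_sub_le _ _) _)
    rw [norm_smul, hbd] at h2
    have h3 := hle z hz
    have h4 := hpos z hz
    linarith
  have hloc : IsLocalMin (fun ζ => ‖f₁ ζ‖ ^ 2 + ‖f₂ ζ‖ ^ 2) ζ₀ := by
    filter_upwards [Metric.isOpen_ball.mem_nhds hball] with ζ hζ
    rw [← solutionPair_norm_sq, ← solutionPair_norm_sq]
    exact pow_le_pow_left₀ (norm_nonneg _) (hle ζ (Metric.ball_subset_closedBall hζ)) 2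
  have hcrit := hloc.hasFDerivAt_eq_zero
    (hasFDerivAt_norm_sq_add_norm_sq (h₁ ζ₀ hζ₀) (h₂ ζ₀ hζ₀))
  have hs : conj (f₁ ζ₀) * g₁ ζ₀ + conj (f₂ ζ₀) * g₂ ζ₀ = 0 := by
    set s := conj (f₁ ζ₀) * g₁ ζ₀ + conj (f₂ ζ₀) * g₂ ζ₀
    -- The derivative is `v ↦ Re (2 s v)`; the direction `v = conj s` isolates `‖s‖²`.
    have := DFunLike.congr_fun hcrit (conj s)
    have h0 : 2 * (s.re * s.re + s.im * s.im) = 0 := by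
      simp at this
      linarith
    exact Complex.normSq_eq_zero.1 (by rw [Complex.normSq_apply]; linarith)
  have hlag := lagrange_identity (f₁ ζ₀) (f₂ ζ₀) (g₁ ζ₀) (g₂ ζ₀)
  rw [hs, hW ζ₀ hζ₀, ← solutionPair_norm_sq, ← solutionPair_norm_sq, ← mul_pow, ← hh, ← hh'] at hlag
  have hceq : ‖c‖ = ‖h ζ₀‖ * ‖h' ζ₀‖ := by
    refine (pow_left_inj₀ (norm_nonneg _) (by positivity) two_ne_zero).1 ?_
    simpa using hlag
  have hCζ := hC ζ₀ hζ₀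
  rw [← solutionPair_norm_sq, ← hh, hceq] at hCζ
  have hder : R * ‖h' ζ₀‖ ≤ C * ‖h ζ₀‖ := by
    refine le_of_mul_le_mul_left ?_ (hpos ζ₀ hζ₀)
    linarith
  have h5 := (hM ζ₀ hζ₀).2.1
  have h6 : ‖h' z‖ ≤ ‖h' ζ₀‖ + ‖h' ζ₀ - h' z‖ := by
    calc _ = ‖h' ζ₀ - (h' ζ₀ - h' z)‖ := by congr 1; abel
      _ ≤ _ := norm_sub_le _ _
  have h7 : R * ‖h' z‖ ≤ R * ‖h' ζ₀‖ + R * ‖h' ζ₀ - h' z‖ := by nlinarith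
  have h8 : C * ‖h ζ₀‖ ≤ C * ‖h z‖ := mul_le_mul_of_nonneg_left (hle z hz) hC0.le
  have h9 := mul_nonneg hC0.le hp0
  have h10 := hpos z hz
  -- The estimates combine to `R ‖h' z‖ ≤ (3C/2 + 1/2) ‖h z‖`, against the assumed lower bound.
  nlinarith

/-! ### The Wronskian. -/

lemma isOpen_disc : IsOpen disc := Metric.isOpen_ball

lemma IsSolution.hasDerivAt {A f : ℂ → ℂ} (hf : IsSolution A f) {z : ℂ} (hz : z ∈ disc) :
    HasDerivAt f (deriv f z) z :=
  (hf.analytic z hz).differentiableAt.hasDerivAt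

lemma IsSolution.hasDerivAt_deriv {A f : ℂ → ℂ} (hf : IsSolution A f) {z : ℂ} (hz : z ∈ disc) :
    HasDerivAt (deriv f) (-(A z * f z)) z := by
  rw [← eq_neg_of_add_eq_zero_left (hf.ode z hz)]
  exact (hf.analytic z hz).deriv.differentiableAt.hasDerivAt

lemma exists_wronskian_eq {A f₁ f₂ : ℂ → ℂ} (hf₁ : IsSolution A f₁) (hf₂ : IsSolution A f₂) :
    ∃ c : ℂ, ∀ z ∈ disc, deriv f₁ z * f₂ z - f₁ z * deriv f₂ z = c := by
  have hd : ∀ z ∈ disc,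
      HasDerivAt (fun z => deriv f₁ z * f₂ z - f₁ z * deriv f₂ z) 0 z := by
    intro z hz
    refine (((hf₁.hasDerivAt_deriv hz).mul (hf₂.hasDerivAt hz)).sub
      ((hf₁.hasDerivAt hz).mul (hf₂.hasDerivAt_deriv hz))).congr_deriv ?_
    ring
  exact ⟨_, fun z hz => isOpen_disc.is_const_of_deriv_eq_zero
    (convex_ball _ _).isPreconnected
    (fun z hz => (hd z hz).differentiableAt.differentiableWithinAt)
    (fun z hz => (hd z hz).deriv) hz (Metric.mem_ball_self one_pos)⟩

/-- A vanishing Wronskian would make `f₁ / f₂` constant near a point where `f₂ ≠ 0`; the identity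
theorem then spreads the linear relation over the disc. -/
lemma exists_wronskian_ne_zero {A f₁ f₂ : ℂ → ℂ} (hf₁ : IsSolution A f₁) (hf₂ : IsSolution A f₂)
    (hli : LinearIndependent ℂ ![disc.domRestrict f₁, disc.domRestrict f₂]) :
    ∃ c : ℂ, c ≠ 0 ∧ ∀ z ∈ disc, deriv f₁ z * f₂ z - f₁ z * deriv f₂ z = c := by
  obtain ⟨c, hc⟩ := exists_wronskian_eq hf₁ hf₂
  refine ⟨c, ?_, hc⟩
  rintro rfl
  have hne := hli.ne_zero 1
  obtain ⟨z, hz, hfz⟩ : ∃ z ∈ disc, f₂ z ≠ 0 := by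
    by_contra! h
    exact hne (funext fun x => h x x.2)
  obtain ⟨r, hr, hball⟩ : ∃ r > 0, Metric.ball z r ⊆ {ζ | ζ ∈ disc ∧ f₂ ζ ≠ 0} :=
    Metric.mem_nhds_iff.1 (inter_mem (isOpen_disc.mem_nhds hz)
      ((hf₂.hasDerivAt hz).continuousAt.eventually_ne hfz))
  have hd : ∀ ζ ∈ Metric.ball z r, HasDerivAt (fun x => f₁ x / f₂ x) 0 ζ := by
    intro ζ hζ
    obtain ⟨h1, h2⟩ := hball hζ
    refine ((hf₁.hasDerivAt h1).div (hf₂.hasDerivAt h1) h2).congr_deriv ?_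
    rw [hc ζ h1, zero_div]
  have hconst : ∀ ζ ∈ Metric.ball z r, f₁ ζ / f₂ ζ = f₁ z / f₂ z := fun ζ hζ =>
    Metric.isOpen_ball.is_const_of_deriv_eq_zero (convex_ball _ _).isPreconnected
      (fun x hx => (hd x hx).differentiableAt.differentiableWithinAt)
      (fun x hx => (hd x hx).deriv) hζ (Metric.mem_ball_self hr)
  have heq : Set.EqOn f₁ (fun ζ => f₁ z / f₂ z * f₂ ζ) disc := by
    refine hf₁.analytic.eqOn_of_preconnected_of_eventuallyEq
      (analyticOnNhd_const.mul hf₂.analytic) (convex_ball _ _).isPreconnected hz ?_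
    filter_upwards [Metric.ball_mem_nhds z hr] with ζ hζ
    rw [← hconst ζ hζ, div_mul_cancel₀ _ (hball hζ).2]
  have := LinearIndependent.pair_iff.1 hli 1 (-(f₁ z / f₂ z)) (by
    ext x
    have hx := heq x.2
    simp only [Pi.add_apply, Pi.smul_apply, Set.domRestrict_apply, smul_eq_mul, one_mul,
      Pi.zero_apply]
    rw [hx]
    ring)
  exact one_ne_zero this.1

lemma norm_sq_add_norm_sq_pos {x₁ x₂ y₁ y₂ : ℂ} (h : y₁ * x₂ - x₁ * y₂ ≠ 0) :
    0 < ‖x₁‖ ^ 2 + ‖x₂‖ ^ 2 := by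
  refine lt_of_le_of_ne (by positivity) fun h0 => h ?_
  have := lagrange_identity x₁ x₂ y₁ y₂
  rw [← h0, zero_mul] at this
  exact norm_eq_zero.1 (pow_eq_zero_iff two_ne_zero |>.1
    (le_antisymm (by linarith [sq_nonneg ‖conj x₁ * y₁ + conj x₂ * y₂‖]) (sq_nonneg _)))

/-! ### Formulas for the spherical derivative and for `u`. -/

lemma sphericalDeriv_div_eq {f₁ f₂ : ℂ → ℂ} {c : ℂ} (hc : c ≠ 0)
    (h₁ : AnalyticOnNhd ℂ f₁ disc) (h₂ : AnalyticOnNhd ℂ f₂ disc)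
    (hW : ∀ z ∈ disc, deriv f₁ z * f₂ z - f₁ z * deriv f₂ z = c) {z : ℂ} (hz : z ∈ disc) :
    sphericalDeriv (fun ζ => f₁ ζ / f₂ ζ) z = ‖c‖ / (‖f₁ z‖ ^ 2 + ‖f₂ z‖ ^ 2) := by
  -- If `f₂` vanished near `z`, so would the Wronskian; hence poles of the quotient are isolated and
  -- the punctured limit avoids them.
  have hne : ∀ᶠ ζ in 𝓝[≠] z, f₂ ζ ≠ 0 := by
    refine (h₂ z hz).eventually_eq_zero_or_eventually_ne_zero.resolve_left fun h0 => hc ?_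
    rw [← hW z hz, h0.self_of_nhds, EventuallyEq.deriv_eq (f := fun _ => (0 : ℂ)) h0]
    simp
  refine Tendsto.limUnder_eq ?_
  have hcont : Tendsto (fun ζ => ‖c‖ / (‖f₁ ζ‖ ^ 2 + ‖f₂ ζ‖ ^ 2)) (𝓝[≠] z)
      (𝓝 (‖c‖ / (‖f₁ z‖ ^ 2 + ‖f₂ z‖ ^ 2))) := by
    refine Tendsto.mono_left ?_ nhdsWithin_le_nhds
    exact tendsto_const_nhds.div (((h₁ z hz).continuousAt.norm.pow 2).add
      ((h₂ z hz).continuousAt.norm.pow 2))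
      (norm_sq_add_norm_sq_pos (by rw [hW z hz]; exact hc)).ne'
  refine hcont.congr' ?_
  filter_upwards [hne, nhdsWithin_le_nhds (isOpen_disc.mem_nhds hz)] with ζ hζ hζd
  rw [((h₁ ζ hζd).differentiableAt.hasDerivAt.fun_div
    (h₂ ζ hζd).differentiableAt.hasDerivAt hζ).deriv, hW ζ hζd, norm_div, norm_div, norm_pow]
  have := norm_pos_iff.2 hζ
  field_simp
  ring

lemma uFun_eq {f₁ f₂ : ℂ → ℂ} {c : ℂ} (hc : c ≠ 0)
    (h₁ : AnalyticOnNhd ℂ f₁ disc) (h₂ : AnalyticOnNhd ℂ f₂ disc)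
    (hW : ∀ z ∈ disc, deriv f₁ z * f₂ z - f₁ z * deriv f₂ z = c) {z : ℂ} (hz : z ∈ disc) :
    uFun f₁ f₂ z = Real.log (‖f₁ z‖ ^ 2 + ‖f₂ z‖ ^ 2) - Real.log ‖c‖ := by
  have hN := norm_sq_add_norm_sq_pos (by rw [hW z hz]; exact hc)
  rw [uFun, sphericalDeriv_div_eq hc h₁ h₂ hW hz,
    Real.log_div (norm_ne_zero_iff.2 hc) hN.ne']
  ring

lemma hasFDerivAt_uFun {f₁ f₂ : ℂ → ℂ} {c : ℂ} (hc : c ≠ 0)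
    (h₁ : AnalyticOnNhd ℂ f₁ disc) (h₂ : AnalyticOnNhd ℂ f₂ disc)
    (hW : ∀ z ∈ disc, deriv f₁ z * f₂ z - f₁ z * deriv f₂ z = c) {z : ℂ} (hz : z ∈ disc) :
    HasFDerivAt (uFun f₁ f₂) ((‖f₁ z‖ ^ 2 + ‖f₂ z‖ ^ 2)⁻¹ • Complex.reCLM.comp
        ((2 * (conj (f₁ z) * deriv f₁ z + conj (f₂ z) * deriv f₂ z)) •
          (ContinuousLinearMap.id ℝ ℂ))) z := by
  have hN := norm_sq_add_norm_sq_pos (by rw [hW z hz]; exact hc)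
  refine (((hasFDerivAt_norm_sq_add_norm_sq (h₁ z hz).differentiableAt.hasDerivAt
    (h₂ z hz).differentiableAt.hasDerivAt).log hN.ne').sub_const
      (Real.log ‖c‖)).congr_of_eventuallyEq ?_
  filter_upwards [isOpen_disc.mem_nhds hz] with ζ hζ
  exact uFun_eq hc h₁ h₂ hW hζ

lemma norm_gradient_eq_norm_fderiv (u : ℂ → ℝ) (z : ℂ) : ‖gradient u z‖ = ‖fderiv ℝ u z‖ := by
  rw [← toDual_gradient, LinearIsometryEquiv.norm_map]

lemma norm_gradient_uFun_le {f₁ f₂ : ℂ → ℂ} {c : ℂ} (hc : c ≠ 0)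
    (h₁ : AnalyticOnNhd ℂ f₁ disc) (h₂ : AnalyticOnNhd ℂ f₂ disc)
    (hW : ∀ z ∈ disc, deriv f₁ z * f₂ z - f₁ z * deriv f₂ z = c) {z : ℂ} (hz : z ∈ disc) :
    ‖gradient (uFun f₁ f₂) z‖ * ‖solutionPair f₁ f₂ z‖ ≤
      2 * ‖solutionPair (deriv f₁) (deriv f₂) z‖ := by
  have hN := norm_sq_add_norm_sq_pos (by rw [hW z hz]; exact hc)
  rw [norm_gradient_eq_norm_fderiv, (hasFDerivAt_uFun hc h₁ h₂ hW hz).fderiv, norm_smul, norm_inv]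
  have hs := lagrange_identity (f₁ z) (f₂ z) (deriv f₁ z) (deriv f₂ z)
  rw [← solutionPair_norm_sq, ← solutionPair_norm_sq, ← mul_pow] at hs
  rw [← solutionPair_norm_sq] at hN ⊢
  set s := conj (f₁ z) * deriv f₁ z + conj (f₂ z) * deriv f₂ z
  set p := ‖solutionPair f₁ f₂ z‖
  set q := ‖solutionPair (deriv f₁) (deriv f₂) z‖
  have hp : 0 < p := lt_of_le_of_ne (norm_nonneg _) (by rintro h; simp [← h] at hN)
  have hsle : ‖s‖ ≤ p * q := by
    refine abs_le_of_sq_le_sq' ?_ (mul_nonneg (norm_nonneg _) (norm_nonneg _)) |>.2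
    linarith [sq_nonneg ‖deriv f₁ z * f₂ z - f₁ z * deriv f₂ z‖]
  have hop : ‖Complex.reCLM.comp ((2 * s) • ContinuousLinearMap.id ℝ ℂ)‖ ≤ 2 * ‖s‖ := by
    refine ContinuousLinearMap.opNorm_le_bound _ (by positivity) fun x => ?_
    refine (Complex.abs_re_le_norm _).trans ?_
    simp [mul_assoc]
  rw [Real.norm_of_nonneg (by positivity)]
  calc (p ^ 2)⁻¹ * _ * p ≤ (p ^ 2)⁻¹ * (2 * (p * q)) * p := by gcongr; linarith
    _ = 2 * q := by field_simp

lemma norm_wronskian_le (x₁ x₂ y₁ y₂ : ℂ) : ‖y₁ * x₂ - x₁ * y₂‖ ^ 2 ≤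
      (‖x₁‖ ^ 2 + ‖x₂‖ ^ 2) * (‖y₁‖ ^ 2 + ‖y₂‖ ^ 2) := by
  rw [← lagrange_identity]
  exact le_add_of_nonneg_left (sq_nonneg _)

/-! ### The two local estimates on a disc of radius `R`. -/

lemma bounds_of_norm_gradient_le {A f₁ f₂ : ℂ → ℂ} {c z : ℂ} {R L : ℝ} (hc : c ≠ 0)
    (hf₁ : IsSolution A f₁) (hf₂ : IsSolution A f₂)
    (hW : ∀ z ∈ disc, deriv f₁ z * f₂ z - f₁ z * deriv f₂ z = c) (hR : 0 < R)
    (hsub : Metric.closedBall z R ⊆ disc)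
    (hL : ∀ ζ ∈ Metric.closedBall z R, ‖gradient (uFun f₁ f₂) ζ‖ * R ≤ L) :
    ‖A z‖ * R ^ 2 ≤ 2 * Real.exp L ∧
      sphericalDeriv (fun ζ => f₁ ζ / f₂ ζ) z * R ≤ Real.exp L := by
  have hzb : z ∈ Metric.closedBall z R := Metric.mem_closedBall_self hR.le
  have hz := hsub hzb
  have hL0 : 0 ≤ L := le_trans (by positivity) (hL z hzb)
  have hN : ∀ ζ ∈ disc, 0 < ‖f₁ ζ‖ ^ 2 + ‖f₂ ζ‖ ^ 2 := fun ζ hζ =>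
    norm_sq_add_norm_sq_pos (by rw [hW ζ hζ]; exact hc)
  set h := solutionPair f₁ f₂ with hh
  set h' := solutionPair (deriv f₁) (deriv f₂) with hh'
  have hp : 0 < ‖h z‖ := by
    have := hN z hz
    rw [← solutionPair_norm_sq] at this
    exact lt_of_le_of_ne (norm_nonneg _) (by rintro h0; simp [← hh, ← h0] at this)
  have hd : ∀ ζ ∈ disc, HasDerivAt h (h' ζ) ζ :=
    fun ζ hζ => (hf₁.hasDerivAt hζ).solutionPair (hf₂.hasDerivAt hζ)
  have hd' : ∀ ζ ∈ disc, HasDerivAt h' (-(A ζ • h ζ)) ζ := by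
    intro ζ hζ
    have := HasDerivAt.solutionPair (g₁ := fun ζ => -(A ζ * f₁ ζ)) (g₂ := fun ζ => -(A ζ * f₂ ζ))
      (hf₁.hasDerivAt_deriv hζ) (hf₂.hasDerivAt_deriv hζ)
    convert this using 1
    ext i
    fin_cases i <;> simp [hh, solutionPair]
  have hbound : ∀ ζ ∈ Metric.closedBall z R, ‖h ζ‖ ≤ Real.exp L * ‖h z‖ := by
    intro ζ hζ
    have hu := (convex_closedBall z R).norm_image_sub_le_of_norm_hasFDerivWithin_le
      (C := L / R) (fun x hx =>
        (hasFDerivAt_uFun hc hf₁.analytic hf₂.analytic hW (hsub hx)).hasFDerivWithinAt)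
      (fun x hx => by
        rw [← (hasFDerivAt_uFun hc hf₁.analytic hf₂.analytic hW (hsub hx)).fderiv,
          ← norm_gradient_eq_norm_fderiv, le_div_iff₀ hR]
        exact hL x hx) hzb hζ
    rw [uFun_eq hc hf₁.analytic hf₂.analytic hW (hsub hζ),
      uFun_eq hc hf₁.analytic hf₂.analytic hW hz, sub_sub_sub_cancel_right] at hu
    have hu2 : L / R * ‖ζ - z‖ ≤ L := by
      calc L / R * ‖ζ - z‖ ≤ L / R * R :=
            mul_le_mul_of_nonneg_left (mem_closedBall_iff_norm.1 hζ) (by positivity)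
        _ = L := by field_simp
    have hu3 := (le_abs_self _).trans (hu.trans hu2)
    rw [← Real.log_div (hN ζ (hsub hζ)).ne' (hN z hz).ne',
      Real.log_le_iff_le_exp (div_pos (hN ζ (hsub hζ)) (hN z hz)), div_le_iff₀ (hN z hz),
      ← solutionPair_norm_sq, ← solutionPair_norm_sq, ← hh] at hu3
    -- The factor `exp (L / 2)` would do; `exp L` avoids the square root.
    refine abs_le_of_sq_le_sq' ?_ (by positivity) |>.2
    have := Real.one_le_exp hL0
    calc ‖h ζ‖ ^ 2 ≤ Real.exp L * ‖h z‖ ^ 2 := hu3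
      _ ≤ Real.exp L ^ 2 * ‖h z‖ ^ 2 := by gcongr; nlinarith
      _ = _ := by ring
  have hdc : DiffContOnCl ℂ h (Metric.ball z R) := by
    refine DifferentiableOn.diffContOnCl ?_
    rw [closure_ball z hR.ne']
    exact fun ζ hζ => (hd ζ (hsub hζ)).differentiableAt.differentiableWithinAt
  have hsph : ∀ ζ ∈ Metric.sphere z R, ‖h ζ‖ ≤ Real.exp L * ‖h z‖ :=
    fun ζ hζ => hbound ζ (Metric.sphere_subset_closedBall hζ)
  constructor
  · have h2 := Complex.norm_iteratedDeriv_le_of_forall_mem_sphere_norm_le 2 hR hdc hsph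
    have he : deriv h =ᶠ[𝓝 z] h' := by
      filter_upwards [isOpen_disc.mem_nhds hz] with ζ hζ using (hd ζ hζ).deriv
    rw [iteratedDeriv_succ, iteratedDeriv_one, he.deriv_eq, (hd' z hz).deriv, norm_neg, norm_smul,
      le_div_iff₀ (by positivity)] at h2
    refine le_of_mul_le_mul_right ?_ hp
    norm_num [Nat.factorial] at h2
    linarith
  · have h1 := Complex.norm_deriv_le_of_forall_mem_sphere_norm_le hR hdc hsph
    rw [(hd z hz).deriv, le_div_iff₀ hR] at h1
    have h3 := norm_wronskian_le (f₁ z) (f₂ z) (deriv f₁ z) (deriv f₂ z)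
    rw [hW z hz, ← solutionPair_norm_sq, ← solutionPair_norm_sq, ← mul_pow] at h3
    have h4 : ‖c‖ ≤ ‖h z‖ * ‖h' z‖ := abs_le_of_sq_le_sq' h3 (by positivity) |>.2
    rw [sphericalDeriv_div_eq hc hf₁.analytic hf₂.analytic hW hz, ← solutionPair_norm_sq, ← hh,
      div_mul_eq_mul_div, div_le_iff₀ (by positivity)]
    calc ‖c‖ * R ≤ ‖h z‖ * ‖h' z‖ * R := by gcongr
      _ = ‖h z‖ * (‖h' z‖ * R) := by ring
      _ ≤ ‖h z‖ * (Real.exp L * ‖h z‖) := by gcongr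
      _ = _ := by ring

lemma norm_gradient_le_of_bounds {A f₁ f₂ : ℂ → ℂ} {c z : ℂ} {R C : ℝ} (hc : c ≠ 0)
    (hf₁ : IsSolution A f₁) (hf₂ : IsSolution A f₂)
    (hW : ∀ z ∈ disc, deriv f₁ z * f₂ z - f₁ z * deriv f₂ z = c) (hR : 0 < R)
    (hsub : Metric.closedBall z R ⊆ disc)
    (hA : ∀ ζ ∈ Metric.closedBall z R, ‖A ζ‖ * R ^ 2 ≤ 1 / 4)
    (hC : ∀ ζ ∈ Metric.closedBall z R, sphericalDeriv (fun ζ => f₁ ζ / f₂ ζ) ζ * R ≤ C) :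
    ‖gradient (uFun f₁ f₂) z‖ * R ≤ 2 * (4 + 2 * C) := by
  have hN : ∀ ζ ∈ disc, 0 < ‖f₁ ζ‖ ^ 2 + ‖f₂ ζ‖ ^ 2 := fun ζ hζ =>
    norm_sq_add_norm_sq_pos (by rw [hW ζ hζ]; exact hc)
  have hz := hsub (Metric.mem_closedBall_self hR.le)
  have h1 := norm_deriv_le_of_wronskian_le (C := C) hR (fun ζ hζ => hf₁.hasDerivAt (hsub hζ))
    (fun ζ hζ => hf₂.hasDerivAt (hsub hζ)) (fun ζ hζ => hf₁.hasDerivAt_deriv (hsub hζ))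
    (fun ζ hζ => hf₂.hasDerivAt_deriv (hsub hζ)) hc (fun ζ hζ => hW ζ (hsub hζ)) hA
    (fun ζ hζ => by
      have := hC ζ hζ
      rw [sphericalDeriv_div_eq hc hf₁.analytic hf₂.analytic hW (hsub hζ), div_mul_eq_mul_div,
        div_le_iff₀ (hN ζ (hsub hζ))] at this
      linarith)
  have h2 := norm_gradient_uFun_le hc hf₁.analytic hf₂.analytic hW hz
  have hp : 0 < ‖solutionPair f₁ f₂ z‖ := by
    have := hN z hz
    rw [← solutionPair_norm_sq] at this
    exact lt_of_le_of_ne (norm_nonneg _) (by rintro h0; simp [← h0] at this)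
  refine le_of_mul_le_mul_right ?_ hp
  nlinarith

/-! ### From local estimates to weighted suprema. -/

/-- Regularity with `s = 1/2` applies whichever of `‖z‖`, `‖ζ‖` is smaller, as `‖ζ - z‖` is at most
half the distance from either point to the circle. -/
lemma IsRegularWeight.exists_le_mul {ω : ℂ → ℝ} (hω : IsRegularWeight ω) :
    ∃ C : ℝ, 1 ≤ C ∧ ∀ z ∈ disc, ∀ ζ ∈ Metric.closedBall z ((1 - ‖z‖) / 2),
      ζ ∈ disc ∧ ω z ≤ C * ω ζ := by
  obtain ⟨C, hC1, hC⟩ := hω.regular (1 / 2) (by norm_num) (by norm_num)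
  refine ⟨C, hC1, fun z hz ζ hζ => ?_⟩
  have hz1 : ‖z‖ < 1 := mem_ball_zero_iff.1 hz
  rw [mem_closedBall_iff_norm] at hζ
  have h1 : ‖ζ‖ ≤ ‖z‖ + ‖ζ - z‖ := by simpa using norm_add_le z (ζ - z)
  have h2 : ‖z‖ ≤ ‖ζ‖ + ‖ζ - z‖ := by
    rw [norm_sub_rev]
    simpa using norm_add_le ζ (z - ζ)
  have hζd : ζ ∈ disc := mem_ball_zero_iff.2 (by linarith)
  have hζ1 : ‖ζ‖ < 1 := mem_ball_zero_iff.1 hζd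
  refine ⟨hζd, ?_⟩
  rw [hω.radial z hz, hω.radial ζ hζd]
  rcases le_total ‖z‖ ‖ζ‖ with h | h
  · exact (hC ‖z‖ ‖ζ‖ (norm_nonneg _) h (by linarith) (by linarith)).2
  · exact (inv_mul_le_iff₀ (by linarith)).1
      (hC ‖ζ‖ ‖z‖ (norm_nonneg _) h (by linarith) (by linarith)).1

lemma memLinfty_iff_exists {E : Type*} [Norm E] {ω : ℂ → ℝ} {f : ℂ → E} :
    MemLinfty ω f ↔ ∃ B : ℝ, ∀ z ∈ disc, ‖f z‖ * ω z ≤ B := by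
  simp [MemLinfty, bddAbove_def]

/-- The local estimates are applied with `R = ω z / k`. Taking `k ≥ 2K` puts the disc where `ω` is
controlled from below by `ω z`. -/
lemma memLinfty_gradient_iff {A f₁ f₂ : ℂ → ℂ} {c : ℂ} (hc : c ≠ 0)
    (hA : AnalyticOnNhd ℂ A disc) (hf₁ : IsSolution A f₁) (hf₂ : IsSolution A f₂)
    (hW : ∀ z ∈ disc, deriv f₁ z * f₂ z - f₁ z * deriv f₂ z = c) {ω : ℂ → ℝ}
    (hω : IsRegularWeight ω) (hbd : BddAbove ((fun z => ω z / (1 - ‖z‖)) '' disc)) :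
    MemLinfty ω (fun z => ‖gradient (uFun f₁ f₂) z‖) ↔
      MemHinfty (fun z => ω z ^ 2) A ∧
        MemLinfty ω (sphericalDeriv (fun ζ => f₁ ζ / f₂ ζ)) := by
  obtain ⟨C, hC1, hC⟩ := hω.exists_le_mul
  obtain ⟨K, hK⟩ := hbd
  have hK' : ∀ z ∈ disc, ω z ≤ K * (1 - ‖z‖) := fun z hz => by
    have hz1 : ‖z‖ < 1 := mem_ball_zero_iff.1 hz
    exact (div_le_iff₀ (by linarith)).1 (hK ⟨z, hz, rfl⟩)
  have hball : ∀ k, 0 < k → 2 * K ≤ k → ∀ z ∈ disc, ∀ ζ ∈ Metric.closedBall z (ω z / k),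
      ζ ∈ disc ∧ ω z ≤ C * ω ζ := by
    intro k hk hKk z hz ζ hζ
    have hz1 : ‖z‖ < 1 := mem_ball_zero_iff.1 hz
    refine hC z hz ζ (Metric.closedBall_subset_closedBall ?_ hζ)
    rw [div_le_iff₀ hk]
    nlinarith [hK' z hz]
  simp only [MemHinfty, hA, true_and]
  simp only [memLinfty_iff_exists, norm_norm]
  have hsn : ∀ z ∈ disc, 0 ≤ sphericalDeriv (fun ζ => f₁ ζ / f₂ ζ) z := fun z hz => by
    rw [sphericalDeriv_div_eq hc hf₁.analytic hf₂.analytic hW hz]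
    positivity
  constructor
  · rintro ⟨B, hB⟩
    set k := max (2 * K) 1
    have hk : 0 < k := lt_of_lt_of_le one_pos (le_max_right _ _)
    have key : ∀ z ∈ disc, ‖A z‖ * (ω z / k) ^ 2 ≤ 2 * Real.exp (C * B / k) ∧
        sphericalDeriv (fun ζ => f₁ ζ / f₂ ζ) z * (ω z / k) ≤ Real.exp (C * B / k) := by
      intro z hz
      have hb := hball k hk (le_max_left _ _) z hz
      refine bounds_of_norm_gradient_le hc hf₁ hf₂ hW (div_pos (hω.pos z hz) hk)
        (fun ζ hζ => (hb ζ hζ).1) fun ζ hζ => ?_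
      rw [← mul_div_assoc]
      refine div_le_div_of_nonneg_right ?_ hk.le
      calc _ ≤ ‖gradient (uFun f₁ f₂) ζ‖ * (C * ω ζ) := by gcongr; exact (hb ζ hζ).2
        _ = C * (‖gradient (uFun f₁ f₂) ζ‖ * ω ζ) := by ring
        _ ≤ C * B := by gcongr; exact hB ζ (hb ζ hζ).1
    refine ⟨⟨2 * Real.exp (C * B / k) * k ^ 2, fun z hz => ?_⟩,
      ⟨Real.exp (C * B / k) * k, fun z hz => ?_⟩⟩
    · have := (key z hz).1
      rw [div_pow, ← mul_div_assoc, div_le_iff₀ (by positivity)] at this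
      exact this
    · have := (key z hz).2
      rw [← mul_div_assoc, div_le_iff₀ hk] at this
      rwa [Real.norm_of_nonneg (hsn z hz)]
  · rintro ⟨⟨B₁, hB₁⟩, ⟨B₂, hB₂⟩⟩
    have hB₁0 : 0 ≤ B₁ := le_trans (by positivity) (hB₁ 0 (Metric.mem_ball_self one_pos))
    -- The second entry makes `C² B₁ / k² ≤ 1/4`, the smallness of `R² A` needed for the minimum
    -- argument.
    set k := max (2 * K) (2 * C * (B₁ + 1))
    have hk2 : 2 * C * (B₁ + 1) ≤ k := le_max_right _ _
    have hk : 0 < k := lt_of_lt_of_le (by positivity) hk2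
    have hkB : 4 * (C ^ 2 * B₁) ≤ k ^ 2 := by
      calc 4 * (C ^ 2 * B₁) ≤ (2 * C * (B₁ + 1)) ^ 2 := by nlinarith [sq_nonneg (C * B₁), sq_nonneg C]
        _ ≤ k ^ 2 := by gcongr
    refine ⟨2 * (4 + 2 * (C * B₂ / k)) * k, fun z hz => ?_⟩
    have hb := hball k hk (le_max_left _ _) z hz
    have hωz := hω.pos z hz
    have := norm_gradient_le_of_bounds (C := C * B₂ / k) hc hf₁ hf₂ hW (div_pos hωz hk)
      (fun ζ hζ => (hb ζ hζ).1) (fun ζ hζ => by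
        rw [div_pow, ← mul_div_assoc, div_le_iff₀ (by positivity)]
        calc ‖A ζ‖ * ω z ^ 2 ≤ ‖A ζ‖ * (C * ω ζ) ^ 2 := by gcongr; exact (hb ζ hζ).2
          _ = C ^ 2 * (‖A ζ‖ * ω ζ ^ 2) := by ring
          _ ≤ C ^ 2 * B₁ := by gcongr; exact hB₁ ζ (hb ζ hζ).1
          _ ≤ 1 / 4 * k ^ 2 := by linarith) (fun ζ hζ => by
        have hζd := (hb ζ hζ).1
        have h0 := hsn ζ hζd
        have h1 := hB₂ ζ hζd
        rw [Real.norm_of_nonneg h0] at h1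
        rw [← mul_div_assoc]
        refine div_le_div_of_nonneg_right ?_ hk.le
        calc _ ≤ sphericalDeriv (fun ζ => f₁ ζ / f₂ ζ) ζ * (C * ω ζ) := by
              gcongr; exact (hb ζ hζ).2
          _ = C * (sphericalDeriv (fun ζ => f₁ ζ / f₂ ζ) ζ * ω ζ) := by ring
          _ ≤ C * B₂ := by gcongr)
    rwa [← mul_div_assoc, div_le_iff₀ hk] at this

/-! ### The weight `1 - |z|²`. -/

lemma stdWeight_one (z : ℂ) : stdWeight 1 z = 1 - ‖z‖ ^ 2 := Real.rpow_one _

lemma stdWeight_two (z : ℂ) : stdWeight 2 z = stdWeight 1 z ^ 2 := by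
  rw [stdWeight_one, stdWeight]
  exact Real.rpow_two _

lemma isRegularWeight_stdWeight_one : IsRegularWeight (stdWeight 1) where
  pos z hz := by
    have hz1 : ‖z‖ < 1 := mem_ball_zero_iff.1 hz
    rw [stdWeight_one]
    nlinarith [norm_nonneg z]
  bounded := ⟨1, fun z _ => by
    rw [stdWeight_one]
    linarith [sq_nonneg ‖z‖]⟩
  continuousOn := by
    simp only [funext stdWeight_one]
    fun_prop
  radial z _ := by simp [stdWeight_one]
  regular s hs0 hs1 := by
    have hs : 0 < 1 - s := by linarith
    -- The constant comes from `1 - r² ≤ 2 (1 - r)` and `(1 - s)(1 - r) ≤ 1 - t ≤ 1 - t²`.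
    refine ⟨2 / (1 - s), (one_le_div hs).2 (by linarith), fun r t hr hrt hts hlt => ?_⟩
    simp only [stdWeight_one, Complex.norm_real, Real.norm_eq_abs, sq_abs]
    have hr1 : r < 1 := by nlinarith
    have ht1 : (1 - s) * (1 - r) ≤ 1 - t := by linarith
    constructor
    · rw [inv_mul_le_iff₀ (by positivity)]
      have h1 : (1 : ℝ) ≤ 2 / (1 - s) := (one_le_div hs).2 (by linarith)
      have h2 : 0 ≤ 1 - r ^ 2 := by nlinarith
      nlinarith
    · rw [div_mul_eq_mul_div, le_div_iff₀ hs]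
      have h3 : (1 - r ^ 2) * (1 - s) ≤ 2 * ((1 - s) * (1 - r)) := by
        nlinarith [mul_nonneg hs.le (mul_self_nonneg (1 - r))]
      nlinarith

lemma bddAbove_stdWeight_one_div : BddAbove ((fun z => stdWeight 1 z / (1 - ‖z‖)) '' disc) := by
  refine ⟨2, ?_⟩
  rintro _ ⟨z, hz, rfl⟩
  have hz1 : ‖z‖ < 1 := mem_ball_zero_iff.1 hz
  simp only [stdWeight_one]
  rw [div_le_iff₀ (by linarith)]
  nlinarith [norm_nonneg z]

theorem mainTheorem2 (A f₁ f₂ : ℂ → ℂ)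
    (hA : AnalyticOnNhd ℂ A disc)
    (hf₁ : IsSolution A f₁) (hf₂ : IsSolution A f₂)
    (hli : LinearIndependent ℂ ![disc.domRestrict f₁, disc.domRestrict f₂]) :
    -- `(f₁ / f₂)^#` is strictly positive and `u` is differentiable, so that `∇ u` makes sense
    ((∀ z ∈ disc, 0 < sphericalDeriv (fun ζ => f₁ ζ / f₂ ζ) z) ∧
      DifferentiableOn ℝ (uFun f₁ f₂) disc) ∧
    -- general regular weights
    (∀ ω : ℂ → ℝ, IsRegularWeight ω →
      BddAbove ((fun z => ω z / (1 - ‖z‖)) '' disc) →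
      (MemLinfty ω (fun z => ‖gradient (uFun f₁ f₂) z‖) ↔
        MemHinfty (fun z => ω z ^ 2) A ∧
          MemLinfty ω (sphericalDeriv (fun ζ => f₁ ζ / f₂ ζ)))) ∧
    -- the weight `1 - |z|²`
    (MemLinfty (stdWeight 1) (fun z => ‖gradient (uFun f₁ f₂) z‖) ↔
      MemHinfty (stdWeight 2) A ∧ IsNormalFunction (fun ζ => f₁ ζ / f₂ ζ)) := by
  obtain ⟨c, hc, hW⟩ := exists_wronskian_ne_zero hf₁ hf₂ hli
  have hpos : ∀ z ∈ disc, 0 < sphericalDeriv (fun ζ => f₁ ζ / f₂ ζ) z := fun z hz => by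
    rw [sphericalDeriv_div_eq hc hf₁.analytic hf₂.analytic hW hz]
    exact div_pos (norm_pos_iff.2 hc) (norm_sq_add_norm_sq_pos (by rw [hW z hz]; exact hc))
  refine ⟨⟨hpos, fun z hz => (hasFDerivAt_uFun hc hf₁.analytic hf₂.analytic hW
    hz).differentiableAt.differentiableWithinAt⟩,
    fun ω hω hbd => memLinfty_gradient_iff hc hA hf₁ hf₂ hW hω hbd, ?_⟩
  rw [memLinfty_gradient_iff hc hA hf₁ hf₂ hW isRegularWeight_stdWeight_one
    bddAbove_stdWeight_one_div, ← funext stdWeight_two]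
  refine and_congr_right fun _ => ?_
  have hmer : MeromorphicOn (fun ζ => f₁ ζ / f₂ ζ) disc := fun z hz =>
    (hf₁.analytic z hz).meromorphicAt.fun_div (hf₂.analytic z hz).meromorphicAt
  rw [IsNormalFunction, and_iff_right hmer, MemLinfty]
  refine iff_of_eq (congrArg BddAbove (Set.image_congr fun z hz => ?_))
  rw [Real.norm_of_nonneg (hpos z hz).le, stdWeight_one]
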